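/- Let $T>0$, $p>0$, $c\in\mathbb R$, and let $e:\mathbb R\to\mathbb R$ be continuous and $T$-periodic with $\int_0^T e(t)\,dt=0$. For $\mu\in\mathbb R$ consider the equation $$u''(t)+c\,u'(t)+\frac{1}{u(t)^p}=\mu+e(t),\qquad t\in\mathbb R. \tag{1}$$ By a positive $T$-periodic classical solution of (1) we mean a twice continuously differentiable function $u:\mathbb R\to(0,\infty)$ with $u(t+T)=u(t)$ for all $t$ that satisfies (1) for every $t\in\mathbb R$. Write $u(t)=\xi+U(t)$ with $\int_0^T U(t)\,dt=0$, so that $\xi=\frac1T\int_0^T u(t)\,dt$ is the average of $u$. Then the following hold. (i) Equation (1) has a unique positive $T$-periodic classical solution if and only if $\mu>0$; for $\mu\le 0$ it has no positive $T$-periodic classical solution. (ii) The average $\xi$ is a global parameter: for every $\xi>0$ there is exactly one pair $(u,\mu)$ such that $\mu\in\mathbb R$ and $u$ is a positive $T$-periodic classical solution of (1) with average $\xi$. (iii) There is a function $\varphi:(0,\infty)\to\mathbb R$ such that the set of all pairs $(\xi,\mu)$ for which (1) has a positive $T$-periodic classical solution with average $\xi$ is exactly the curve $\{(\xi,\varphi(\xi)):\xi>0\}$.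 It is the only function on $(0,\infty)$ whose graph contains all these pairs. The function $\varphi$ is continuous and strictly decreasing on $(0,\infty)$, with $\lim_{\xi\to0^+}\varphi(\xi)=\infty$ and $\lim_{\xi\to\infty}\varphi(\xi)=0$. -/

import Mathlib

open Set Filter Topology

/-- `u` is a positive `T`-periodic classical (i.e. twice continuously differentiable) solution of
`u''(t) + c u'(t) + 1 / u(t)^p = μ + e(t)` on the whole real line. -/
structure IsPositivePeriodicSolution (T c p : ℝ) (e : ℝ → ℝ) (μ : ℝ) (u : ℝ → ℝ) : Prop where
  contDiff : ContDiff ℝ 2 u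
  periodic : Function.Periodic u T
  pos : ∀ t, 0 < u t
  equation : ∀ t, deriv (deriv u) t + c * deriv u t + 1 / (u t) ^ p = μ + e t

/-- The average `ξ = (1/T) ∫_0^T u(t) dt` of a `T`-periodic function, that is, the constant `ξ`
in the decomposition `u = ξ + U` with `∫_0^T U(t) dt = 0`. -/
noncomputable def periodAverage (T : ℝ) (u : ℝ → ℝ) : ℝ :=
  (1 / T) * ∫ t in (0 : ℝ)..T, u t

/-! Write `L u = u'' + c u'`. At a maximum of `w` one has `L w ≤ 0`, and `x ↦ 1 / x ^ p` is strictly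
decreasing on the positive axis, so every positive periodic subsolution lies below every positive
periodic supersolution (`le_of_dampedOp_add_le`, `lt_of_dampedOp_add_lt`). This yields uniqueness,
strict decrease of the solution in `μ`, and all later estimates.

Because `e` has mean zero, `L E = e` has a periodic solution (`exists_periodic_dampedOp_eq`).
Comparing `u` with `E` forces `μ > 0`, and shifts of `E` serve as barriers. For `μ > 0` a solution
exists between a small constant and a shift of `E` (`exists_periodic_between`): the nonlinearity is
altered outside the relevant range so that a contraction solves the problem, and comparison brings
the solution back into that range.

The average is then a strictly decreasing function `A` of `μ > 0`. Barriers show that it is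
continuous and takes arbitrarily small and large values, so it is a bijection of the positive axis,
and `φ` is its inverse. -/

/-- The damped second-order operator `u'' + c u'`. -/
noncomputable def dampedOp (c : ℝ) (u : ℝ → ℝ) (t : ℝ) : ℝ :=
  deriv (deriv u) t + c * deriv u t

/-! ### Maximum principle and comparison -/

theorem Function.Periodic.exists_forall_le {T : ℝ} (hT : 0 < T) {f : ℝ → ℝ}
    (hf : Continuous f) (hp : Function.Periodic f T) : ∃ t₀, ∀ t, f t ≤ f t₀ := by
  obtain ⟨_, ⟨t₀, rfl⟩, h⟩ :=
    (hp.compact_of_continuous hT.ne' hf).exists_isGreatest (range_nonempty f)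
  exact ⟨t₀, fun t => h ⟨t, rfl⟩⟩

theorem Function.Periodic.exists_forall_ge {T : ℝ} (hT : 0 < T) {f : ℝ → ℝ}
    (hf : Continuous f) (hp : Function.Periodic f T) : ∃ t₀, ∀ t, f t₀ ≤ f t := by
  obtain ⟨_, ⟨t₀, rfl⟩, h⟩ :=
    (hp.compact_of_continuous hT.ne' hf).exists_isLeast (range_nonempty f)
  exact ⟨t₀, fun t => h ⟨t, rfl⟩⟩

/-- A positive second derivative would make `t₀` a local minimum as well, hence `w` locally
constant, a contradiction. -/
theorem deriv_deriv_nonpos_of_forall_le {w : ℝ → ℝ} (hw : Continuous w) {t₀ : ℝ}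
    (h : ∀ t, w t ≤ w t₀) : deriv (deriv w) t₀ ≤ 0 := by
  have hmax : IsLocalMax w t₀ := Eventually.of_forall h
  by_contra! hpos
  have hmin := isLocalMin_of_deriv_deriv_pos hpos hmax.deriv_eq_zero hw.continuousAt
  have hconst : w =ᶠ[𝓝 t₀] fun _ => w t₀ := by
    filter_upwards [hmin] with t ht using le_antisymm (h t) ht
  have : deriv (deriv w) t₀ = 0 := by
    rw [hconst.deriv.deriv_eq]; simp
  exact hpos.ne' this

theorem dampedOp_nonpos_of_forall_le (c : ℝ) {w : ℝ → ℝ} (hw : Continuous w) {t₀ : ℝ}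
    (h : ∀ t, w t ≤ w t₀) : dampedOp c w t₀ ≤ 0 := by
  have hmax : IsLocalMax w t₀ := Eventually.of_forall h
  simpa [dampedOp, hmax.deriv_eq_zero] using deriv_deriv_nonpos_of_forall_le hw h

theorem ContDiff.differentiable_deriv_of_two {u : ℝ → ℝ} (hu : ContDiff ℝ 2 u) :
    Differentiable ℝ (deriv u) :=
  (contDiff_succ_iff_deriv.1 (show ContDiff ℝ (1 + 1) u by simpa [one_add_one_eq_two] using hu)).2.2
    |>.differentiable one_ne_zero

theorem ContDiff.differentiable_of_two {u : ℝ → ℝ} (hu : ContDiff ℝ 2 u) :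
    Differentiable ℝ u :=
  hu.differentiable two_ne_zero

theorem dampedOp_sub (c : ℝ) {u v : ℝ → ℝ} (hu : ContDiff ℝ 2 u) (hv : ContDiff ℝ 2 v) (t : ℝ) :
    dampedOp c (fun s => u s - v s) t = dampedOp c u t - dampedOp c v t := by
  have h1 : deriv (fun s => u s - v s) = fun s => deriv u s - deriv v s := funext fun s =>
    deriv_fun_sub (hu.differentiable_of_two s) (hv.differentiable_of_two s)
  unfold dampedOp
  rw [h1, deriv_fun_sub (hu.differentiable_deriv_of_two t) (hv.differentiable_deriv_of_two t)]
  ring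

theorem dampedOp_add_const (c a : ℝ) (u : ℝ → ℝ) (t : ℝ) :
    dampedOp c (fun s => u s + a) t = dampedOp c u t := by
  have h1 : deriv (fun s => u s + a) = deriv u := funext fun s => deriv_add_const a
  unfold dampedOp
  rw [h1]

theorem dampedOp_const (c a t : ℝ) : dampedOp c (fun _ => a) t = 0 := by
  simp [dampedOp]

/-- Comparison principle: an ordered pair of a supersolution `β` and a subsolution `α`. -/
theorem le_of_dampedOp_add_le {T c : ℝ} (hT : 0 < T) {G : ℝ → ℝ} {s : Set ℝ}
    (hG : StrictAntiOn G s) {α β : ℝ → ℝ} (hα : ContDiff ℝ 2 α) (hβ : ContDiff ℝ 2 β)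
    (hαT : Function.Periodic α T) (hβT : Function.Periodic β T)
    (hαs : ∀ t, α t ∈ s) (hβs : ∀ t, β t ∈ s)
    (h : ∀ t, dampedOp c β t + G (β t) ≤ dampedOp c α t + G (α t)) (t : ℝ) : α t ≤ β t := by
  have hc : Continuous fun s => α s - β s := hα.continuous.sub hβ.continuous
  obtain ⟨t₀, ht₀⟩ := Function.Periodic.exists_forall_le hT hc (hαT.sub hβT)
  have hop := dampedOp_nonpos_of_forall_le c hc ht₀
  rw [dampedOp_sub c hα hβ] at hop
  have h1 : G (β t₀) ≤ G (α t₀) := by linarith [h t₀]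
  have h2 := (hG.le_iff_ge (hβs t₀) (hαs t₀)).1 h1
  linarith [ht₀ t]

/-- Strict comparison principle. -/
theorem lt_of_dampedOp_add_lt {T c : ℝ} (hT : 0 < T) {G : ℝ → ℝ} {s : Set ℝ}
    (hG : StrictAntiOn G s) {α β : ℝ → ℝ} (hα : ContDiff ℝ 2 α) (hβ : ContDiff ℝ 2 β)
    (hαT : Function.Periodic α T) (hβT : Function.Periodic β T)
    (hαs : ∀ t, α t ∈ s) (hβs : ∀ t, β t ∈ s)
    (h : ∀ t, dampedOp c β t + G (β t) < dampedOp c α t + G (α t)) (t : ℝ) : α t < β t := by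
  have hc : Continuous fun s => α s - β s := hα.continuous.sub hβ.continuous
  obtain ⟨t₀, ht₀⟩ := Function.Periodic.exists_forall_le hT hc (hαT.sub hβT)
  have hop := dampedOp_nonpos_of_forall_le c hc ht₀
  rw [dampedOp_sub c hα hβ] at hop
  have h1 : G (β t₀) < G (α t₀) := by linarith [h t₀]
  have h2 := (hG.lt_iff_gt (hβs t₀) (hαs t₀)).1 h1
  linarith [ht₀ t]

/-! ### First-order periodic equations -/

/-- The periodic solution of `v' - r v = h`. -/
noncomputable def periodicResolvent (T r : ℝ) (h : ℝ → ℝ) (t : ℝ) : ℝ :=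
  Real.exp (r * t) * (∫ s in (t - T)..t, Real.exp (-(r * s)) * h s) / (1 - Real.exp (r * T))

/-- The window integral has derivative `f t - f (t - T)`. By periodicity of `h`, the factor `exp (r
t)` turns this into `(1 - exp (r T)) h t`, cancelling the denominator. -/
theorem hasDerivAt_periodicResolvent {T r : ℝ} (hT : 0 < T) (hr : r ≠ 0) {h : ℝ → ℝ}
    (hc : Continuous h) (hp : Function.Periodic h T) (t : ℝ) :
    HasDerivAt (periodicResolvent T r h) (r * periodicResolvent T r h t + h t) t := by
  have hd : 1 - Real.exp (r * T) ≠ 0 := by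
    rw [sub_ne_zero, ne_comm, Ne, Real.exp_eq_one_iff]
    exact mul_ne_zero hr hT.ne'
  set f : ℝ → ℝ := fun s => Real.exp (-(r * s)) * h s with hf
  have hfc : Continuous f := by fun_prop
  have hH : ∀ x, HasDerivAt (fun x => ∫ s in (0 : ℝ)..x, f s) (f x) x := fun x =>
    hfc.integral_hasStrictDerivAt 0 x |>.hasDerivAt
  have hI : (fun x => ∫ s in (x - T)..x, f s) =
      fun x => (∫ s in (0 : ℝ)..x, f s) - ∫ s in (0 : ℝ)..(x - T), f s := by
    funext x
    rw [intervalIntegral.integral_interval_sub_left (hfc.intervalIntegrable _ _)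
      (hfc.intervalIntegrable _ _)]
  have hI' : HasDerivAt (fun x => ∫ s in (x - T)..x, f s) (f t - f (t - T)) t := by
    rw [hI]
    exact (hH t).sub ((hH (t - T)).comp_sub_const t T)
  have hE : HasDerivAt (fun x => Real.exp (r * x)) (Real.exp (r * t) * r) t := by
    simpa using ((hasDerivAt_id t).const_mul r).exp
  have := (hE.mul hI').div_const (1 - Real.exp (r * T))
  refine this.congr_deriv ?_
  have hpt : h (t - T) = h t := hp.sub_eq t
  have e1 : Real.exp (r * t) * Real.exp (-(r * t)) = 1 := by rw [← Real.exp_add]; simp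
  have e2 : Real.exp (r * t) * Real.exp (-(r * (t - T))) = Real.exp (r * T) := by
    rw [← Real.exp_add]; ring_nf
  have e3 : Real.exp (r * t) * (f t - f (t - T)) = h t * (1 - Real.exp (r * T)) := by
    simp only [hf, hpt]
    linear_combination h t * e1 - h t * e2
  rw [e3, periodicResolvent, ← hf]
  field_simp

theorem periodic_periodicResolvent {T r : ℝ} {h : ℝ → ℝ} (hp : Function.Periodic h T) :
    Function.Periodic (periodicResolvent T r h) T := by
  intro t
  unfold periodicResolvent
  have : ∫ s in (t + T - T)..(t + T), Real.exp (-(r * s)) * h s =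
      Real.exp (-(r * T)) * ∫ s in (t - T)..t, Real.exp (-(r * s)) * h s := by
    rw [show t + T - T = t - T + T by ring, ← intervalIntegral.integral_comp_add_right
      (fun s => Real.exp (-(r * s)) * h s) T, ← intervalIntegral.integral_const_mul]
    congr 1
    funext s
    rw [hp s, ← mul_assoc, ← Real.exp_add]
    ring_nf
  rw [this, ← mul_assoc, ← Real.exp_add]
  ring_nf

/-- At the extrema of `v` the derivative vanishes, so `r v = -h` there. The sharp constant `1 / |r|`
is what makes the later fixed-point map a contraction. -/
theorem abs_mul_abs_le_of_hasDerivAt {T r C : ℝ} (hT : 0 < T) {v h : ℝ → ℝ}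
    (hv : ∀ t, HasDerivAt v (r * v t + h t) t) (hp : Function.Periodic v T)
    (hC : ∀ t, |h t| ≤ C) (t : ℝ) : |r| * |v t| ≤ C := by
  have hvc : Continuous v := continuous_iff_continuousAt.2 fun t => (hv t).continuousAt
  obtain ⟨a, ha⟩ := Function.Periodic.exists_forall_le hT hvc hp
  obtain ⟨b, hb⟩ := Function.Periodic.exists_forall_ge hT hvc hp
  have ha' : r * v a + h a = 0 :=
    IsLocalMax.hasDerivAt_eq_zero (Eventually.of_forall ha) (hv a)
  have hb' : r * v b + h b = 0 :=
    IsLocalMin.hasDerivAt_eq_zero (Eventually.of_forall hb) (hv b)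
  have key : ∀ x, r * v x + h x = 0 → |r| * |v x| ≤ C := fun x hx => by
    rw [← abs_mul, show r * v x = -h x by linarith, abs_neg]; exact hC x
  have hle : |v t| ≤ max |v a| |v b| := by
    rw [max_comm]; exact abs_le_max_abs_abs (hb t) (ha t)
  rcases le_max_iff.1 hle with h1 | h1
  · exact (mul_le_mul_of_nonneg_left h1 (abs_nonneg r)).trans (key a ha')
  · exact (mul_le_mul_of_nonneg_left h1 (abs_nonneg r)).trans (key b hb')

theorem contDiff_two_of_hasDerivAt {u v w : ℝ → ℝ} (hu : ∀ t, HasDerivAt u (v t) t)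
    (hv : ∀ t, HasDerivAt v (w t) t) (hw : Continuous w) : ContDiff ℝ 2 u := by
  have eu : deriv u = v := funext fun t => (hu t).deriv
  have ev : deriv v = w := funext fun t => (hv t).deriv
  have h1 : ContDiff ℝ 1 v :=
    contDiff_one_iff_deriv.2 ⟨fun t => (hv t).differentiableAt, ev ▸ hw⟩
  have := (contDiff_succ_iff_deriv (n := 1) (f := u) (𝕜 := ℝ)).2
    ⟨fun t => (hu t).differentiableAt, by simp, eu ▸ h1⟩
  simpa [one_add_one_eq_two] using this

theorem dampedOp_eq_of_hasDerivAt (c : ℝ) {u v w : ℝ → ℝ} (hu : ∀ t, HasDerivAt u (v t) t)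
    (hv : ∀ t, HasDerivAt v (w t) t) (t : ℝ) : dampedOp c u t = w t + c * v t := by
  have eu : deriv u = v := funext fun t => (hu t).deriv
  rw [dampedOp, eu, (hv t).deriv]

/-! ### Solvability by contraction -/

/-- The space of continuous `T`-periodic functions, with the sup norm. -/
abbrev PeriodicBCF (T : ℝ) : Type :=
  {f : BoundedContinuousFunction ℝ ℝ // Function.Periodic f T}

instance completeSpace_periodicBCF (T : ℝ) : CompleteSpace (PeriodicBCF T) := by
  have hcl : IsClosed {f : BoundedContinuousFunction ℝ ℝ | Function.Periodic f T} := by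
    simp only [Function.Periodic, ofPred_forall]
    exact isClosed_iInter fun t => isClosed_eq (continuous_eval_const _)
      (continuous_eval_const _)
  exact hcl.isComplete.completeSpace_coe

theorem Function.Periodic.exists_periodicBCF {T : ℝ} (hT : 0 < T) {f : ℝ → ℝ} (hf : Continuous f)
    (hp : Function.Periodic f T) : ∃ F : PeriodicBCF T, ∀ t, F.1 t = f t := by
  obtain ⟨C, hC⟩ := (hp.isBounded_of_continuous hT.ne' hf).exists_norm_le
  exact ⟨⟨BoundedContinuousFunction.ofNormedAddCommGroup f hf C fun t => hC _ ⟨t, rfl⟩, hp⟩,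
    fun t => rfl⟩

/-- A periodic nonlinear problem whose nonlinearity decreases with slopes between `m` and `K`
is solvable. -/
theorem exists_periodic_dampedOp_add_eq {T c m K : ℝ} (hT : 0 < T) (hm : 0 < m) (hmK : m ≤ K)
    {G h : ℝ → ℝ} (hG : ∀ x y, x ≤ y → m * (y - x) ≤ G x - G y ∧ G x - G y ≤ K * (y - x))
    (hc : Continuous h) (hp : Function.Periodic h T) :
    ∃ u : ℝ → ℝ, ContDiff ℝ 2 u ∧ Function.Periodic u T ∧
      ∀ t, dampedOp c u t + G (u t) = h t := by
  have hK : 0 < K := hm.trans_le hmK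
  -- Roots of `r² + c r - K`, so that `L - K` factors as `(D - r₁)(D - r₂)`.
  obtain ⟨r₁, r₂, hsum, hprod⟩ : ∃ r₁ r₂ : ℝ, r₁ + r₂ = -c ∧ r₁ * r₂ = -K := by
    refine ⟨(-c + √(c ^ 2 + 4 * K)) / 2, (-c - √(c ^ 2 + 4 * K)) / 2, by ring, ?_⟩
    have := Real.sq_sqrt (show 0 ≤ c ^ 2 + 4 * K by positivity)
    linear_combination -this / 4
  have hr₁ : r₁ ≠ 0 := by rintro rfl; simp at hprod; exact hK.ne' hprod
  have hr₂ : r₂ ≠ 0 := by rintro rfl; simp at hprod; exact hK.ne' hprod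
  have hrabs : |r₁| * |r₂| = K := by rw [← abs_mul, hprod, abs_neg, abs_of_pos hK]
  -- The equation becomes `L u - K u = h - N u`; the slopes of `N` lie in `[0, K - m]`.
  set N : ℝ → ℝ := fun x => G x + K * x with hN
  have hNlip : ∀ x y, |N x - N y| ≤ (K - m) * |x - y| := by
    have key : ∀ x y, x ≤ y → |N x - N y| ≤ (K - m) * |x - y| := fun x y hxy => by
      obtain ⟨h1, h2⟩ := hG x y hxy
      rw [abs_sub_comm x y, abs_of_nonneg (sub_nonneg.2 hxy), abs_le]
      simp only [hN]
      constructor <;> nlinarith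
    intro x y
    rcases le_total x y with hxy | hxy
    · exact key x y hxy
    · rw [abs_sub_comm, abs_sub_comm x]; exact key y x hxy
  have hNc : Continuous N := by
    have : LipschitzWith (Real.toNNReal (K - m)) N := LipschitzWith.of_dist_le_mul fun x y => by
      rw [Real.coe_toNNReal _ (sub_nonneg.2 hmK)]; exact hNlip x y
    exact this.continuous
  have hFc : ∀ u : PeriodicBCF T, Continuous fun t => h t - N (u.1 t) := fun u =>
    hc.sub (hNc.comp u.1.continuous)
  have hFp : ∀ u : PeriodicBCF T, Function.Periodic (fun t => h t - N (u.1 t)) T := fun u t => by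
    simp only [hp t, u.2 t]
  set V : PeriodicBCF T → ℝ → ℝ := fun u => periodicResolvent T r₂ fun t => h t - N (u.1 t)
  have hVd : ∀ u t, HasDerivAt (V u) (r₂ * V u t + (h t - N (u.1 t))) t := fun u =>
    hasDerivAt_periodicResolvent hT hr₂ (hFc u) (hFp u)
  have hVc : ∀ u, Continuous (V u) := fun u =>
    continuous_iff_continuousAt.2 fun t => (hVd u t).continuousAt
  have hVp : ∀ u, Function.Periodic (V u) T := fun u => periodic_periodicResolvent (hFp u)
  set W : PeriodicBCF T → ℝ → ℝ := fun u => periodicResolvent T r₁ (V u)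
  have hWd : ∀ u t, HasDerivAt (W u) (r₁ * W u t + V u t) t := fun u =>
    hasDerivAt_periodicResolvent hT hr₁ (hVc u) (hVp u)
  have hWc : ∀ u, Continuous (W u) := fun u =>
    continuous_iff_continuousAt.2 fun t => (hWd u t).continuousAt
  have hWp : ∀ u, Function.Periodic (W u) T := fun u => periodic_periodicResolvent (hVp u)
  choose Φ hΦ using fun u => Function.Periodic.exists_periodicBCF hT (hWc u) (hWp u)
  -- Inverting the two factors costs `1 / (|r₁| |r₂|) = 1 / K`, so the Lipschitz constant is `(K -
  -- m) / K < 1`.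
  have hbound : ∀ u v t, |W u t - W v t| ≤ (K - m) / K * dist u v := fun u v t => by
    have h1 : ∀ t, |r₂| * |V u t - V v t| ≤ (K - m) * dist u v := by
      refine abs_mul_abs_le_of_hasDerivAt hT (v := fun t => V u t - V v t)
        (h := fun t => (h t - N (u.1 t)) - (h t - N (v.1 t)))
        (fun t => ((hVd u t).sub (hVd v t)).congr_deriv (by ring)) ((hVp u).sub (hVp v)) fun t => ?_
      rw [show h t - N (u.1 t) - (h t - N (v.1 t)) = -(N (u.1 t) - N (v.1 t)) by ring, abs_neg]
      exact (hNlip _ _).trans (mul_le_mul_of_nonneg_left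
        (BoundedContinuousFunction.dist_coe_le_dist (f := u.1) (g := v.1) t) (sub_nonneg.2 hmK))
    have h2 : |r₁| * |W u t - W v t| ≤ (K - m) * dist u v / |r₂| := by
      refine abs_mul_abs_le_of_hasDerivAt hT (v := fun t => W u t - W v t)
        (h := fun t => V u t - V v t)
        (fun t => ((hWd u t).sub (hWd v t)).congr_deriv (by ring)) ((hWp u).sub (hWp v))
        (fun t => ?_) t
      rw [le_div_iff₀ (abs_pos.2 hr₂), mul_comm]
      exact h1 t
    rw [le_div_iff₀ (abs_pos.2 hr₂)] at h2
    rw [div_mul_eq_mul_div, le_div_iff₀ hK]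
    calc |W u t - W v t| * K = |r₁| * |W u t - W v t| * |r₂| := by rw [← hrabs]; ring
      _ ≤ _ := h2
  have hq : (K - m) / K < 1 := by rw [div_lt_one hK]; linarith
  have hq0 : 0 ≤ (K - m) / K := div_nonneg (sub_nonneg.2 hmK) hK.le
  have hcontr : ContractingWith (Real.toNNReal ((K - m) / K)) Φ := by
    refine ⟨by rwa [Real.toNNReal_lt_one], LipschitzWith.of_dist_le_mul fun u v => ?_⟩
    rw [Real.coe_toNNReal _ hq0]
    refine (BoundedContinuousFunction.dist_le (by positivity)).2 fun t => ?_
    rw [hΦ, hΦ]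
    exact hbound u v t
  have : Nonempty (PeriodicBCF T) := ⟨⟨0, fun t => rfl⟩⟩
  set u := ContractingWith.fixedPoint Φ hcontr
  have hfix : Φ u = u := hcontr.fixedPoint_isFixedPt
  have huW : ∀ t, W u t = u.1 t := fun t => by rw [← hΦ, hfix]
  have hWd2 : ∀ t, HasDerivAt (fun t => r₁ * W u t + V u t)
      (r₁ * (r₁ * W u t + V u t) + (r₂ * V u t + (h t - N (u.1 t)))) t := fun t =>
    ((hWd u t).const_mul r₁).add (hVd u t)
  refine ⟨W u, contDiff_two_of_hasDerivAt (hWd u) hWd2 ?_, hWp u, fun t => ?_⟩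
  · have := hWc u
    have := hVc u
    have := hFc u
    fun_prop
  · rw [dampedOp_eq_of_hasDerivAt c (hWd u) hWd2, huW]
    simp only [hN]
    have hc' : c = -(r₁ + r₂) := by linarith
    have hK' : K = -(r₁ * r₂) := by linarith
    rw [hc', hK']
    ring

/-! ### Sub- and supersolutions -/

/-- The nonlinearity clamped to `[a, b]` and continued with slope `-m`. -/
noncomputable def clampedExtension (g : ℝ → ℝ) (a b m x : ℝ) : ℝ :=
  g (max a (min b x)) - m * (x - max a (min b x))

theorem clampedExtension_of_mem {g : ℝ → ℝ} {a b m x : ℝ} (hx : x ∈ Icc a b) :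
    clampedExtension g a b m x = g x := by
  simp [clampedExtension, min_eq_right hx.2, max_eq_right hx.1]

/-- Clamping is monotone and 1-Lipschitz. The clamped increment contributes slopes between `m` and
`K`, the remaining increment exactly `m`. -/
theorem clampedExtension_slope {g : ℝ → ℝ} {a b m K : ℝ} (hab : a ≤ b) (hmK : m ≤ K)
    (hg : ∀ x ∈ Icc a b, ∀ y ∈ Icc a b, x ≤ y →
      m * (y - x) ≤ g x - g y ∧ g x - g y ≤ K * (y - x)) (x y : ℝ) (hxy : x ≤ y) :
    m * (y - x) ≤ clampedExtension g a b m x - clampedExtension g a b m y ∧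
      clampedExtension g a b m x - clampedExtension g a b m y ≤ K * (y - x) := by
  have hmem : ∀ z, max a (min b z) ∈ Icc a b := fun z =>
    ⟨le_max_left _ _, max_le hab (min_le_left _ _)⟩
  have hle : max a (min b x) ≤ max a (min b y) := by gcongr
  have hle2 : max a (min b y) - max a (min b x) ≤ y - x := by grind
  obtain ⟨h1, h2⟩ := hg _ (hmem x) _ (hmem y) hle
  unfold clampedExtension
  constructor <;> nlinarith

/-- The method of sub- and supersolutions. -/
theorem exists_periodic_between {T c m K a b : ℝ} (hT : 0 < T) (hm : 0 < m) (hmK : m ≤ K)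
    {g h α β : ℝ → ℝ} (hg : ∀ x ∈ Icc a b, ∀ y ∈ Icc a b, x ≤ y →
      m * (y - x) ≤ g x - g y ∧ g x - g y ≤ K * (y - x))
    (hc : Continuous h) (hp : Function.Periodic h T)
    (hα : ContDiff ℝ 2 α) (hβ : ContDiff ℝ 2 β)
    (hαT : Function.Periodic α T) (hβT : Function.Periodic β T)
    (hαs : ∀ t, α t ∈ Icc a b) (hβs : ∀ t, β t ∈ Icc a b)
    (hsub : ∀ t, h t ≤ dampedOp c α t + g (α t))
    (hsup : ∀ t, dampedOp c β t + g (β t) ≤ h t) :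
    ∃ u : ℝ → ℝ, ContDiff ℝ 2 u ∧ Function.Periodic u T ∧ (∀ t, α t ≤ u t ∧ u t ≤ β t) ∧
      ∀ t, dampedOp c u t + g (u t) = h t := by
  have hab : a ≤ b := (hαs 0).1.trans (hαs 0).2
  have hslope := clampedExtension_slope hab hmK hg
  have hanti : StrictAntiOn (clampedExtension g a b m) univ := fun x _ y _ hxy => by
    have := (hslope x y hxy.le).1
    have : 0 < m * (y - x) := mul_pos hm (sub_pos.2 hxy)
    linarith
  obtain ⟨u, hu, huT, hueq⟩ := exists_periodic_dampedOp_add_eq (c := c) hT hm hmK hslope hc hp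
  -- The extension agrees with `g` along `α` and `β`, so comparison for the extended problem traps
  -- `u` where the extension is `g` again.
  have h1 : ∀ t, α t ≤ u t := le_of_dampedOp_add_le (c := c) hT hanti hα hu hαT huT
    (fun _ => mem_univ _) (fun _ => mem_univ _) fun t => by
      rw [hueq, clampedExtension_of_mem (hαs t)]; exact hsub t
  have h2 : ∀ t, u t ≤ β t := le_of_dampedOp_add_le (c := c) hT hanti hu hβ huT hβT
    (fun _ => mem_univ _) (fun _ => mem_univ _) fun t => by
      rw [hueq, clampedExtension_of_mem (hβs t)]; exact hsup t
  refine ⟨u, hu, huT, fun t => ⟨h1 t, h2 t⟩, fun t => ?_⟩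
  rw [← hueq t, clampedExtension_of_mem ⟨(hαs t).1.trans (h1 t), (h2 t).trans (hβs t).2⟩]

/-! ### The linear equation -/

/-- Periodic solvability of the linear equation with a mean-zero forcing. -/
theorem exists_periodic_dampedOp_eq {T : ℝ} (hT : 0 < T) (c : ℝ) {e : ℝ → ℝ} (he : Continuous e)
    (hp : Function.Periodic e T) (hmean : ∫ t in (0 : ℝ)..T, e t = 0) :
    ∃ E : ℝ → ℝ, ContDiff ℝ 2 E ∧ Function.Periodic E T ∧ ∀ t, dampedOp c E t = e t := by
  have hprim : ∀ {f : ℝ → ℝ}, Continuous f → Function.Periodic f T →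
      ∫ t in (0 : ℝ)..T, f t = 0 → (∀ t, HasDerivAt (fun x => ∫ s in (0 : ℝ)..x, f s) (f t) t) ∧
        Function.Periodic (fun x => ∫ s in (0 : ℝ)..x, f s) T := by
    intro f hf hfp hf0
    refine ⟨fun t => (hf.integral_hasStrictDerivAt 0 t).hasDerivAt, fun t => ?_⟩
    have h1 := intervalIntegral.integral_add_adjacent_intervals
      (hf.intervalIntegrable (μ := MeasureTheory.volume) 0 t) (hf.intervalIntegrable t (t + T))
    have h2 := hfp.intervalIntegral_add_eq t 0
    simp only [zero_add] at h2
    simp only [← h1, h2, hf0, add_zero]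
  -- One integration reduces the equation to `u' + c u = w` up to a constant. If `c = 0`, the mean
  -- of `w` must be removed before integrating again; otherwise the resolvent with `r = -c` applies.
  obtain ⟨hw, hwp⟩ := hprim he hp hmean
  set w : ℝ → ℝ := fun x => ∫ s in (0 : ℝ)..x, e s
  have hwc : Continuous w := continuous_iff_continuousAt.2 fun t => (hw t).continuousAt
  rcases eq_or_ne c 0 with rfl | hc
  · set k : ℝ := (1 / T) * ∫ s in (0 : ℝ)..T, w s with hk
    have hw0 : ∫ t in (0 : ℝ)..T, (w t - k) = 0 := by
      rw [intervalIntegral.integral_sub (hwc.intervalIntegrable _ _) (by simp)]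
      simp only [intervalIntegral.integral_const, smul_eq_mul, sub_zero, hk]
      field_simp
      ring
    obtain ⟨hy, hyp⟩ := hprim (hwc.sub continuous_const) (fun t => congrArg (· - k) (hwp t)) hw0
    have hy2 : ∀ t, HasDerivAt (fun t => w t - k) (e t) t := fun t => (hw t).sub_const k
    refine ⟨_, contDiff_two_of_hasDerivAt hy hy2 he, hyp, fun t => ?_⟩
    rw [dampedOp_eq_of_hasDerivAt 0 hy hy2]
    ring
  · have hy := hasDerivAt_periodicResolvent hT (neg_ne_zero.2 hc) hwc hwp
    have hy2 : ∀ t, HasDerivAt (fun t => -c * periodicResolvent T (-c) w t + w t)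
        (-c * (-c * periodicResolvent T (-c) w t + w t) + e t) t := fun t =>
      ((hy t).const_mul (-c)).add (hw t)
    refine ⟨_, contDiff_two_of_hasDerivAt hy hy2 ?_, periodic_periodicResolvent hwp, fun t => ?_⟩
    · have : Continuous (periodicResolvent T (-c) w) :=
        continuous_iff_continuousAt.2 fun t => (hy t).continuousAt
      fun_prop
    · rw [dampedOp_eq_of_hasDerivAt c hy hy2]
      ring

/-! ### The singular nonlinearity -/

theorem strictAntiOn_one_div_rpow {p : ℝ} (hp : 0 < p) :
    StrictAntiOn (fun x : ℝ => 1 / x ^ p) (Ioi 0) := fun _ hx _ _ hxy =>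
  one_div_lt_one_div_of_lt (Real.rpow_pos_of_pos hx p)
    (Real.rpow_lt_rpow (le_of_lt hx) hxy hp)

theorem exists_one_div_rpow_eq {p y : ℝ} (hp : 0 < p) (hy : 0 < y) :
    ∃ x : ℝ, 0 < x ∧ 1 / x ^ p = y := by
  refine ⟨y ^ (-(1 / p)), Real.rpow_pos_of_pos hy _, ?_⟩
  rw [← Real.rpow_mul hy.le, show -(1 / p) * p = -1 by field_simp, Real.rpow_neg_one, one_div,
    inv_inv]

/-- Mean value theorem: `p z ^ (-p - 1)` decreases in `z`, so its values at `b` and `a` serve as `m`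
and `K`. -/
theorem one_div_rpow_slope {p a b : ℝ} (hp : 0 < p) (ha : 0 < a) (hab : a ≤ b) :
    ∃ m K : ℝ, 0 < m ∧ m ≤ K ∧ ∀ x ∈ Icc a b, ∀ y ∈ Icc a b, x ≤ y →
      m * (y - x) ≤ 1 / x ^ p - 1 / y ^ p ∧ 1 / x ^ p - 1 / y ^ p ≤ K * (y - x) := by
  have hmono : ∀ {x y : ℝ}, 0 < x → x ≤ y → p * y ^ (-p - 1) ≤ p * x ^ (-p - 1) := fun hx hxy =>
    mul_le_mul_of_nonneg_left (Real.rpow_le_rpow_of_nonpos hx hxy (by linarith)) hp.le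
  refine ⟨p * b ^ (-p - 1), p * a ^ (-p - 1), ?_, hmono ha hab, fun x hx y hy hxy => ?_⟩
  · have : 0 < b := ha.trans_le hab
    positivity
  rcases hxy.eq_or_lt with rfl | hlt
  · simp
  have hx0 : 0 < x := ha.trans_le hx.1
  have hd : ∀ z : ℝ, 0 < z → HasDerivAt (fun z : ℝ => z ^ (-p)) (-p * z ^ (-p - 1)) z :=
    fun z hz => Real.hasDerivAt_rpow_const (Or.inl hz.ne')
  obtain ⟨z, hz, hzeq⟩ := exists_hasDerivAt_eq_slope (fun z : ℝ => z ^ (-p))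
    (fun z => -p * z ^ (-p - 1)) hlt
    (fun z hz => (hd z (hx0.trans_le hz.1)).continuousAt.continuousWithinAt)
    (fun z hz => hd z (hx0.trans hz.1))
  rw [eq_div_iff (sub_pos.2 hlt).ne', Real.rpow_neg (hx0.trans hlt).le, Real.rpow_neg hx0.le,
    ← one_div, ← one_div] at hzeq
  have h1 := hmono (hx0.trans hz.1) (hz.2.le.trans hy.2)
  have h2 := hmono ha (hx.1.trans hz.1.le)
  have hs := (sub_pos.2 hlt).le
  constructor
  · linarith [mul_le_mul_of_nonneg_right h1 hs]
  · linarith [mul_le_mul_of_nonneg_right h2 hs]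

/-- The positive gap is continuous and periodic, so it attains a positive minimum `η`. This slack
absorbs a change of `μ` when a solution is shifted by a constant. -/
theorem exists_add_le_one_div_rpow {T p δ : ℝ} (hT : 0 < T) (hp : 0 < p) (hδ : 0 < δ) {u : ℝ → ℝ}
    (hu : Continuous u) (huT : Function.Periodic u T) (hpos : ∀ t, 0 < u t) :
    ∃ η > 0, ∀ t, 1 / (u t + δ) ^ p + η ≤ 1 / (u t) ^ p := by
  have hc : Continuous fun t => 1 / (u t) ^ p - 1 / (u t + δ) ^ p := by
    have h0 : ∀ t, 0 < u t + δ := fun t => add_pos (hpos t) hδ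
    refine (continuous_const.div (hu.rpow_const fun t => Or.inl (hpos t).ne') fun t =>
      (Real.rpow_pos_of_pos (hpos t) p).ne').sub (continuous_const.div
      ((hu.add continuous_const).rpow_const fun t => Or.inl (h0 t).ne') fun t =>
      (Real.rpow_pos_of_pos (h0 t) p).ne')
  obtain ⟨t₀, h⟩ := Function.Periodic.exists_forall_ge (T := T) hT hc fun t => by simp only [huT t]
  refine ⟨_, sub_pos.2 (strictAntiOn_one_div_rpow hp (hpos t₀) (add_pos (hpos t₀) hδ)
    (lt_add_of_pos_right _ hδ)), fun t => ?_⟩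
  linarith [h t]

/-! ### Averages over a period -/

theorem periodAverage_mono {T : ℝ} (hT : 0 < T) {u v : ℝ → ℝ} (hu : Continuous u)
    (hv : Continuous v) (h : ∀ t, u t ≤ v t) : periodAverage T u ≤ periodAverage T v :=
  mul_le_mul_of_nonneg_left (intervalIntegral.integral_mono hT.le (hu.intervalIntegrable _ _)
    (hv.intervalIntegrable _ _) h) (by positivity)

theorem periodAverage_strictMono {T : ℝ} (hT : 0 < T) {u v : ℝ → ℝ} (hu : Continuous u)
    (hv : Continuous v) (h : ∀ t, u t < v t) : periodAverage T u < periodAverage T v :=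
  mul_lt_mul_of_pos_left (intervalIntegral.integral_lt_integral_of_continuousOn_of_le_of_exists_lt
    hT hu.continuousOn hv.continuousOn (fun t _ => (h t).le) ⟨0, ⟨le_rfl, hT.le⟩, h 0⟩)
    (by positivity)

theorem periodAverage_const {T : ℝ} (hT : 0 < T) (a : ℝ) : periodAverage T (fun _ => a) = a := by
  simp [periodAverage, hT.ne']

theorem periodAverage_add_const {T : ℝ} (hT : 0 < T) {u : ℝ → ℝ} (hu : Continuous u) (a : ℝ) :
    periodAverage T (fun t => u t + a) = periodAverage T u + a := by
  rw [periodAverage, intervalIntegral.integral_add (hu.intervalIntegrable _ _) (by simp), mul_add]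
  exact congrArg _ (periodAverage_const hT a)

/-! ### Uniqueness, existence and barriers -/

namespace IsPositivePeriodicSolution

variable {T c p μ ν : ℝ} {e u v : ℝ → ℝ}

theorem dampedOp_eq (hu : IsPositivePeriodicSolution T c p e μ u) (t : ℝ) :
    dampedOp c u t + 1 / (u t) ^ p = μ + e t := hu.equation t

theorem sub_le (hT : 0 < T) (hp : 0 < p) (hu : IsPositivePeriodicSolution T c p e μ u)
    {α : ℝ → ℝ} (hα : ContDiff ℝ 2 α) (hαT : Function.Periodic α T) (hα0 : ∀ t, 0 < α t)
    (h : ∀ t, μ + e t ≤ dampedOp c α t + 1 / (α t) ^ p) (t : ℝ) : α t ≤ u t :=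
  le_of_dampedOp_add_le hT (strictAntiOn_one_div_rpow hp) hα hu.contDiff hαT hu.periodic hα0 hu.pos
    (fun t => (hu.dampedOp_eq t).trans_le (h t)) t

theorem le_super (hT : 0 < T) (hp : 0 < p) (hu : IsPositivePeriodicSolution T c p e μ u)
    {β : ℝ → ℝ} (hβ : ContDiff ℝ 2 β) (hβT : Function.Periodic β T) (hβ0 : ∀ t, 0 < β t)
    (h : ∀ t, dampedOp c β t + 1 / (β t) ^ p ≤ μ + e t) (t : ℝ) : u t ≤ β t :=
  le_of_dampedOp_add_le hT (strictAntiOn_one_div_rpow hp) hu.contDiff hβ hu.periodic hβT hu.pos hβ0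
    (fun t => (h t).trans_eq (hu.dampedOp_eq t).symm) t

theorem unique (hT : 0 < T) (hp : 0 < p) (hu : IsPositivePeriodicSolution T c p e μ u)
    (hv : IsPositivePeriodicSolution T c p e μ v) : u = v := funext fun t =>
  le_antisymm
    (hv.sub_le hT hp hu.contDiff hu.periodic hu.pos (fun t => (hu.dampedOp_eq t).ge) t)
    (hu.sub_le hT hp hv.contDiff hv.periodic hv.pos (fun t => (hv.dampedOp_eq t).ge) t)

theorem lt_of_lt (hT : 0 < T) (hp : 0 < p) (hu : IsPositivePeriodicSolution T c p e μ u)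
    (hv : IsPositivePeriodicSolution T c p e ν v) (hμν : μ < ν) (t : ℝ) : v t < u t :=
  lt_of_dampedOp_add_lt hT (strictAntiOn_one_div_rpow hp) hv.contDiff hu.contDiff hv.periodic
    hu.periodic hv.pos hu.pos
    (fun t => (hu.dampedOp_eq t).trans_lt ((add_lt_add_left hμν (e t)).trans_eq
      (hv.dampedOp_eq t).symm)) t

/-- With `L E = e`, at a maximum of `E - u` one gets `0 ≥ e - L u = 1 / u ^ p - μ`. -/
theorem param_pos (hT : 0 < T) (he : Continuous e) (hper : Function.Periodic e T)
    (hmean : ∫ t in (0 : ℝ)..T, e t = 0) (hu : IsPositivePeriodicSolution T c p e μ u) :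
    0 < μ := by
  obtain ⟨E, hE, hET, hEeq⟩ := exists_periodic_dampedOp_eq hT c he hper hmean
  have hc : Continuous fun t => E t - u t := hE.continuous.sub hu.contDiff.continuous
  obtain ⟨t₀, ht₀⟩ := Function.Periodic.exists_forall_le hT hc (hET.sub hu.periodic)
  have hop := dampedOp_nonpos_of_forall_le c hc ht₀
  rw [dampedOp_sub c hE hu.contDiff, hEeq] at hop
  have := hu.dampedOp_eq t₀
  have : 0 < 1 / (u t₀) ^ p := one_div_pos.2 (Real.rpow_pos_of_pos (hu.pos t₀) p)
  linarith

/-- Existence for every positive parameter: a small constant is a subsolution, and a large shift of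
the periodic solution of the linear equation is a supersolution. -/
theorem exists_of_pos (hT : 0 < T) (hp : 0 < p) (he : Continuous e) (hper : Function.Periodic e T)
    (hmean : ∫ t in (0 : ℝ)..T, e t = 0) (hμ : 0 < μ) :
    ∃ u, IsPositivePeriodicSolution T c p e μ u := by
  obtain ⟨E, hE, hET, hEeq⟩ := exists_periodic_dampedOp_eq hT c he hper hmean
  obtain ⟨tE, htE⟩ := Function.Periodic.exists_forall_ge hT hE.continuous hET
  obtain ⟨sE, hsE⟩ := Function.Periodic.exists_forall_le hT hE.continuous hET
  obtain ⟨te, hte⟩ := Function.Periodic.exists_forall_le hT he hper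
  have hanti := (strictAntiOn_one_div_rpow hp).antitoneOn
  -- The constant `a₁` has `1 / a₁ ^ p ≥ μ + max e`; the `1` only ensures positivity.
  obtain ⟨a₁, ha₁, ha₁e⟩ := exists_one_div_rpow_eq hp
    (show 0 < max (μ + e te) 1 from lt_max_of_lt_right one_pos)
  -- Since `β ≥ b₁`, one has `L β + 1 / β ^ p ≤ e + 1 / b₁ ^ p = e + μ`.
  obtain ⟨b₁, hb₁, hb₁e⟩ := exists_one_div_rpow_eq hp hμ
  set β : ℝ → ℝ := fun t => E t + (b₁ - E tE) with hβ
  have hβ1 : ∀ t, b₁ ≤ β t := fun t => by simp only [hβ]; linarith [htE t]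
  have hβ2 : ∀ t, β t ≤ β sE := fun t => by simp only [hβ]; linarith [hsE t]
  set a := min a₁ b₁
  have ha : 0 < a := lt_min ha₁ hb₁
  have hab : a ≤ β sE := (min_le_right _ _).trans (hβ1 sE)
  obtain ⟨m, K, hm, hmK, hslope⟩ := one_div_rpow_slope hp ha hab
  obtain ⟨u, hu, huT, hbd, hueq⟩ := exists_periodic_between (c := c) (h := fun t => μ + e t)
    (α := fun _ => a) (β := β) hT hm hmK hslope (continuous_const.add he)
    (fun t => by simp only [hper t]) contDiff_const (hE.add contDiff_const) (fun _ => rfl)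
    (fun t => by simp only [hβ, hET t]) (fun _ => ⟨le_rfl, hab⟩)
    (fun t => ⟨(min_le_right _ _).trans (hβ1 t), hβ2 t⟩)
    (fun t => by
      have := hanti ha ha₁ (min_le_left a₁ b₁)
      have := le_max_left (μ + e te) 1
      simp only [dampedOp_const]
      linarith [hte t])
    (fun t => by
      have := hanti hb₁ (hb₁.trans_le (hβ1 t)) (hβ1 t)
      rw [dampedOp_add_const, hEeq]
      linarith)
  exact ⟨u, hu, huT, fun t => ha.trans_le (hbd t).1, hueq⟩

/-- A shift of `E` with minimum `X` is a subsolution once `μ` is at most `1 / x ^ p` at its maximum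
`x`. -/
theorem exists_le_average (hT : 0 < T) (hp : 0 < p) (he : Continuous e)
    (hper : Function.Periodic e T) (hmean : ∫ t in (0 : ℝ)..T, e t = 0) {X : ℝ} (hX : 0 < X) :
    ∃ μ > 0, ∀ u, IsPositivePeriodicSolution T c p e μ u → X ≤ periodAverage T u := by
  obtain ⟨E, hE, hET, hEeq⟩ := exists_periodic_dampedOp_eq hT c he hper hmean
  obtain ⟨tE, htE⟩ := Function.Periodic.exists_forall_ge hT hE.continuous hET
  obtain ⟨sE, hsE⟩ := Function.Periodic.exists_forall_le hT hE.continuous hET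
  set α : ℝ → ℝ := fun t => E t + (X - E tE) with hα
  have h1 : ∀ t, X ≤ α t := fun t => by simp only [hα]; linarith [htE t]
  have h2 : ∀ t, α t ≤ α sE := fun t => by simp only [hα]; linarith [hsE t]
  have h0 : ∀ t, 0 < α t := fun t => hX.trans_le (h1 t)
  refine ⟨1 / (α sE) ^ p, one_div_pos.2 (Real.rpow_pos_of_pos (h0 sE) p), fun u hu => ?_⟩
  have hle := hu.sub_le hT hp (hE.add contDiff_const) (fun t => by simp only [hET t]) h0
    fun t => by
      have : 1 / (α sE) ^ p ≤ 1 / (α t) ^ p :=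
        (strictAntiOn_one_div_rpow hp).antitoneOn (h0 t) (h0 sE) (h2 t)
      rw [dampedOp_add_const, hEeq]
      linarith
  rw [← periodAverage_const hT X]
  exact periodAverage_mono hT continuous_const hu.contDiff.continuous fun t => (h1 t).trans (hle t)

/-- For `μ` this large, the constant `ε` is a supersolution. -/
theorem exists_average_le (hT : 0 < T) (hp : 0 < p) (he : Continuous e)
    (hper : Function.Periodic e T) {ε : ℝ} (hε : 0 < ε) :
    ∃ μ > 0, ∀ u, IsPositivePeriodicSolution T c p e μ u → periodAverage T u ≤ ε := by
  obtain ⟨te, hte⟩ := Function.Periodic.exists_forall_ge hT he hper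
  have hε' : 0 < 1 / ε ^ p := one_div_pos.2 (Real.rpow_pos_of_pos hε p)
  refine ⟨1 / ε ^ p + |e te|, by positivity, fun u hu => ?_⟩
  have hle := hu.le_super hT hp (β := fun _ => ε) contDiff_const (fun _ => rfl) (fun _ => hε)
    fun t => by
      simp only [dampedOp_const]
      linarith [neg_abs_le (e te), hte t]
  exact (periodAverage_mono hT hu.contDiff.continuous continuous_const hle).trans_eq
    (periodAverage_const hT ε)

/-- Upper semicontinuity of the average in the parameter. -/
theorem exists_average_le_add (hT : 0 < T) (hp : 0 < p)
    (hu : IsPositivePeriodicSolution T c p e μ u) {δ : ℝ} (hδ : 0 < δ) :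
    ∃ η > 0, ∀ ν v, μ - η ≤ ν → IsPositivePeriodicSolution T c p e ν v →
      periodAverage T v ≤ periodAverage T u + δ := by
  obtain ⟨η, hη, h⟩ := exists_add_le_one_div_rpow hT hp hδ hu.contDiff.continuous hu.periodic hu.pos
  refine ⟨η, hη, fun ν v hν hv => ?_⟩
  have hle := hv.le_super hT hp (β := fun t => u t + δ) (hu.contDiff.add contDiff_const)
    (fun t => by simp only [hu.periodic t]) (fun t => add_pos (hu.pos t) hδ)
    fun t => by
      rw [dampedOp_add_const]
      linarith [h t, hu.dampedOp_eq t]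
  rw [← periodAverage_add_const hT hu.contDiff.continuous]
  exact periodAverage_mono hT hv.contDiff.continuous
    (hu.contDiff.continuous.add continuous_const) hle

/-- Lower semicontinuity of the average in the parameter. -/
theorem exists_sub_le_average (hT : 0 < T) (hp : 0 < p)
    (hu : IsPositivePeriodicSolution T c p e μ u) {δ : ℝ} (hδ : 0 < δ) :
    ∃ η > 0, ∀ ν v, ν ≤ μ + η → IsPositivePeriodicSolution T c p e ν v →
      periodAverage T u - δ ≤ periodAverage T v := by
  obtain ⟨t₀, ht₀⟩ :=
    Function.Periodic.exists_forall_ge hT hu.contDiff.continuous hu.periodic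
  -- The cap `u t₀ / 2`, half the minimum of `u`, keeps the lowered barrier `u - d` positive.
  set d := min δ (u t₀ / 2)
  have hd0 : 0 < d := lt_min hδ (half_pos (hu.pos t₀))
  have hpos : ∀ t, 0 < u t + -d := fun t => by
    have := min_le_right δ (u t₀ / 2)
    linarith [ht₀ t, hu.pos t₀]
  have hc : ContDiff ℝ 2 fun t => u t + -d := hu.contDiff.add contDiff_const
  have hper : Function.Periodic (fun t => u t + -d) T := fun t => by simp only [hu.periodic t]
  obtain ⟨η, hη, h⟩ := exists_add_le_one_div_rpow hT hp hd0 hc.continuous hper hpos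
  refine ⟨η, hη, fun ν v hν hv => ?_⟩
  have hle := hv.sub_le hT hp hc hper hpos fun t => by
      have := h t
      rw [neg_add_cancel_right] at this
      rw [dampedOp_add_const]
      linarith [hu.dampedOp_eq t]
  have := periodAverage_mono hT hc.continuous hv.contDiff.continuous hle
  rw [periodAverage_add_const hT hu.contDiff.continuous] at this
  linarith [min_le_left δ (u t₀ / 2)]

end IsPositivePeriodicSolution

/-! ### The solution curve -/

theorem mainTheorem1 (T c p : ℝ) (e : ℝ → ℝ) (hT : 0 < T) (hp : 0 < p)
    (he_cont : Continuous e) (he_per : Function.Periodic e T)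
    (he_mean : ∫ t in (0 : ℝ)..T, e t = 0) :
    -- a unique positive periodic solution exists if and only if `μ > 0` ...
    (∀ μ : ℝ, (∃! u : ℝ → ℝ, IsPositivePeriodicSolution T c p e μ u) ↔ 0 < μ) ∧
    -- ... and there is no positive periodic solution at all for `μ ≤ 0`
    (∀ (μ : ℝ) (u : ℝ → ℝ), IsPositivePeriodicSolution T c p e μ u → 0 < μ) ∧
    -- the average is a global parameter for the solution pairs `(u, μ)`
    (∀ ξ : ℝ, 0 < ξ → ∃! q : (ℝ → ℝ) × ℝ,
      IsPositivePeriodicSolution T c p e q.2 q.1 ∧ periodAverage T q.1 = ξ) ∧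
    -- the solution curve `μ = φ(ξ)`
    ∃ φ : ℝ → ℝ,
      {q : ℝ × ℝ | ∃ u : ℝ → ℝ, IsPositivePeriodicSolution T c p e q.2 u ∧
          periodAverage T u = q.1} = (fun ξ : ℝ => (ξ, φ ξ)) '' Ioi 0 ∧
      (∀ ψ : ℝ → ℝ, (∀ (μ : ℝ) (u : ℝ → ℝ), IsPositivePeriodicSolution T c p e μ u →
          μ = ψ (periodAverage T u)) → EqOn ψ φ (Ioi 0)) ∧
      ContinuousOn φ (Ioi 0) ∧
      StrictAntiOn φ (Ioi 0) ∧
      Tendsto φ (𝓝[>] 0) atTop ∧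
      Tendsto φ atTop (𝓝 0) := by
  have hpos : ∀ (μ : ℝ) (u : ℝ → ℝ), IsPositivePeriodicSolution T c p e μ u → 0 < μ :=
    fun μ u hu => hu.param_pos hT he_cont he_per he_mean
  have hex : ∀ μ : ℝ, 0 < μ → ∃ u, IsPositivePeriodicSolution T c p e μ u := fun μ hμ =>
    IsPositivePeriodicSolution.exists_of_pos hT hp he_cont he_per he_mean hμ
  choose! S hS using hex
  have hSu : ∀ {μ u}, IsPositivePeriodicSolution T c p e μ u → u = S μ := fun hu =>
    hu.unique hT hp (hS _ (hpos _ _ hu))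
  set A : ℝ → ℝ := fun μ => periodAverage T (S μ) with hA
  have hAanti : StrictAntiOn A (Ioi 0) := fun μ hμ ν hν h =>
    periodAverage_strictMono hT (hS ν hν).contDiff.continuous (hS μ hμ).contDiff.continuous
      ((hS μ hμ).lt_of_lt hT hp (hS ν hν) h)
  have hA0 : ∀ μ, 0 < μ → 0 < A μ := fun μ hμ => by
    have := periodAverage_strictMono hT continuous_const (hS μ hμ).contDiff.continuous (hS μ hμ).pos
    rwa [periodAverage_const hT] at this
  have hAcont : ContinuousOn A (Ioi 0) := by
    intro μ hμ
    refine Metric.continuousWithinAt_iff.2 fun ε hε => ?_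
    obtain ⟨η₁, hη₁, h₁⟩ := (hS μ hμ).exists_average_le_add hT hp (half_pos hε)
    obtain ⟨η₂, hη₂, h₂⟩ := (hS μ hμ).exists_sub_le_average hT hp (half_pos hε)
    refine ⟨min η₁ η₂, lt_min hη₁ hη₂, fun ν hν hdist => ?_⟩
    rw [Real.dist_eq, abs_lt] at hdist
    have := h₁ ν _ (by linarith [min_le_left η₁ η₂]) (hS ν hν)
    have := h₂ ν _ (by linarith [min_le_right η₁ η₂]) (hS ν hν)
    rw [Real.dist_eq, abs_lt]
    constructor <;> simp only [hA] <;> linarith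
  have hAsurj : ∀ ξ : ℝ, 0 < ξ → ∃ μ : ℝ, 0 < μ ∧ A μ = ξ := fun ξ hξ => by
    obtain ⟨μ₁, hμ₁, h₁⟩ := IsPositivePeriodicSolution.exists_average_le (c := c) hT hp he_cont
      he_per hξ
    obtain ⟨μ₂, hμ₂, h₂⟩ := IsPositivePeriodicSolution.exists_le_average (c := c) hT hp he_cont
      he_per he_mean hξ
    obtain ⟨μ, hμ, h⟩ := isPreconnected_Ioi.intermediate_value hμ₁ hμ₂ hAcont
      ⟨h₁ _ (hS _ hμ₁), h₂ _ (hS _ hμ₂)⟩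
    exact ⟨μ, hμ, h⟩
  choose! φ hφ0 hφ using hAsurj
  have hφA : ∀ μ, 0 < μ → φ (A μ) = μ := fun μ hμ =>
    hAanti.injOn (hφ0 _ (hA0 μ hμ)) hμ (hφ _ (hA0 μ hμ))
  have hφanti : StrictAntiOn φ (Ioi 0) := fun ξ hξ ζ hζ h =>
    (hAanti.lt_iff_gt (hφ0 ξ hξ) (hφ0 ζ hζ)).1 (by rwa [hφ ξ hξ, hφ ζ hζ])
  refine ⟨fun μ => ⟨fun ⟨u, hu, _⟩ => hpos μ u hu, fun hμ => ⟨S μ, hS μ hμ, fun u hu => hSu hu⟩⟩,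
    hpos, fun ξ hξ => ⟨(S (φ ξ), φ ξ), ⟨hS _ (hφ0 ξ hξ), hφ ξ hξ⟩, ?_⟩,
    φ, ?_, ?_, ?_, hφanti, ?_, ?_⟩
  · rintro ⟨u, μ⟩ ⟨hu, hav⟩
    dsimp only at hu hav
    obtain rfl := hSu hu
    have hμ : φ ξ = μ := by rw [← hav]; exact hφA μ (hpos _ _ hu)
    rw [hμ]
  · ext ⟨ξ, μ⟩
    constructor
    · rintro ⟨u, hu, rfl⟩
      dsimp only at hu
      obtain rfl := hSu hu
      have hμ := hpos _ _ hu
      exact ⟨A μ, hA0 μ hμ, Prod.ext rfl (hφA μ hμ)⟩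
    · rintro ⟨ζ, hζ, h⟩
      obtain ⟨rfl, rfl⟩ := Prod.mk.inj h
      exact ⟨S (φ ζ), hS _ (hφ0 ζ hζ), hφ ζ hζ⟩
  · intro ψ hψ ξ hξ
    have h : φ ξ = ψ (A (φ ξ)) := hψ (φ ξ) _ (hS _ (hφ0 ξ hξ))
    rw [hφ ξ hξ] at h
    exact h.symm
  · intro ξ hξ
    have hmono : StrictMonoOn (fun x => -φ x) (Ioi 0) := fun x hx y hy h =>
      neg_lt_neg (hφanti hx hy h)
    -- A monotone function whose image contains a neighbourhood of its value is continuous there;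
    -- `-φ` attains every negative number because `φ` inverts `A`.
    have hc := hmono.continuousAt_of_image_mem_nhds (a := ξ) (Ioi_mem_nhds hξ)
      (mem_of_superset (Iio_mem_nhds (neg_neg_of_pos (hφ0 ξ hξ))) fun y hy =>
        ⟨A (-y), hA0 _ (neg_pos.2 hy), by simp only [hφA _ (neg_pos.2 hy), neg_neg]⟩)
    exact (hc.neg.congr (Eventually.of_forall fun x => neg_neg (φ x))).continuousWithinAt
  · refine tendsto_atTop.2 fun M => ?_
    have hM : 0 < max M 1 := lt_max_of_lt_right one_pos
    filter_upwards [Ioo_mem_nhdsGT (hA0 _ hM)] with ξ hξ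
    have := hφanti hξ.1 (hA0 _ hM) hξ.2
    rw [hφA _ hM] at this
    exact (le_max_left M 1).trans this.le
  · refine Metric.tendsto_atTop.2 fun ε hε => ⟨A (ε / 2), fun ξ hξ => ?_⟩
    have hε2 := half_pos hε
    have hξ0 : 0 < ξ := (hA0 _ hε2).trans_le hξ
    have := hφanti.antitoneOn (hA0 _ hε2) hξ0 hξ
    rw [hφA _ hε2] at this
    rw [Real.dist_eq, sub_zero, abs_of_pos (hφ0 ξ hξ0)]
    linarith
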